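/- Let $\mathcal V\subseteq\mathbf{Cat}$ be a full sub-2-category of the 2-category of small categories that is closed under small limits and exponentials and contains the arrow category $\mathbf 2$ (for example small categories, preorders, or posets). A $\mathcal V$-category is a 2-category whose hom-categories lie in $\mathcal V$; $\mathcal V$-functors and $\mathcal V$-natural transformations are 2-functors and 2-natural transformations. A $\mathcal V$-category is complete if it has all small $\mathcal V$-weighted limits, and a $\mathcal V$-functor is continuous if it preserves them. For a $\mathcal V$-monad $\mathsf T=(T,i,m)$ on $\mathcal C$, let $\mathsf T\text{-}\mathrm{Alg}$ be the $\mathcal V$-category of strict $\mathsf T$-algebras, strict morphisms and their 2-cells, with forgetful $\mathcal V$-functor $V^{\mathsf T}\colon\mathsf T\text{-}\mathrm{Alg}\to\mathcal C$. The monad $\mathsf T$ is lax idempotent if there is a modification $\delta\colon Ti\Rrightarrow iT$ with $m\cdot\delta=1$ and $\delta\cdot i=1$. Let $W\colon\mathcal C\to\mathcal B$ be a continuous $\mathcal V$-functor between complete (not necessarily small) $\mathcal V$-categories, let $\mathsf T$ be a $\mathcal V$-monad on $\mathcal C$ and $\mathsf S$ a $\mathcal V$-monad on $\mathcal B$, and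 let $G\colon\mathsf T\text{-}\mathrm{Alg}\to\mathsf S\text{-}\mathrm{Alg}$ be a $\mathcal V$-functor such that $$\begin{array}{ccc}\mathsf T\text{-}\mathrm{Alg}&\xrightarrow{\;G\;}&\mathsf S\text{-}\mathrm{Alg}\\ {\scriptstyle V^{\mathsf T}}\downarrow&&\downarrow{\scriptstyle V^{\mathsf S}}\\ \mathcal C&\xrightarrow{\;W\;}&\mathcal B\end{array}$$ commutes and is a pullback of $\mathcal V$-categories. If $\mathsf S$ is lax idempotent, then $\mathsf T$ is lax idempotent. -/

import Mathlib

open CategoryTheory Bicategory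

/- Only for elaboration: `X ⟶ Y` should be found through `CategoryStruct`, not through reflexive
quivers. -/
attribute [-instance] CategoryTheory.catToReflQuiver

universe v u u₁ u₂ u₃ u₄

namespace LaxIdem

/-!
Conventions.  A 2-category is a strict bicategory (`Bicategory` with `Bicategory.Strict`), and a
2-functor is a `StrictPseudofunctor`.  All hom-categories are small (`Bicategory.{v, v}`).  Composition
is written in diagrammatic order.  An equation between 2-cells whose (co)domains agree only
propositionally (by an equation between 1-cells which is always available) is written with `HEq`.
-/

section Base

/-- The bases of enrichment: full sub-2-categories `V` of the 2-category `Cat` of small categories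
that are closed under small limits and exponentials, and contain the arrow category `2`.
(Closure under colimits is not required.) -/
structure IsBase (V : ObjectProperty Cat.{v, v}) : Prop where
  limits : ∀ (J : Type v) [SmallCategory J], V.IsClosedUnderLimitsOfShape J
  exponentials : ∀ A B : Cat.{v, v}, V A → V B → V (Cat.of (A ⥤ B))
  two : V (Cat.of (AsSmall.{v} (Fin 2)))

/-- A `V`-category is a 2-category whose hom-categories lie in `V`.  `V` being full in `Cat`,
`V`-functors and `V`-natural transformations are the 2-functors and 2-natural transformations. -/
def IsVCategory (V : ObjectProperty Cat.{v, v}) (C : Type u) [Bicategory.{v, v} C] : Prop :=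
  ∀ X Y : C, V (Cat.of (X ⟶ Y))

end Base

section HEqLemmas

variable {C : Type u₁} [Bicategory.{v, v} C] {D : Type u₂} [Bicategory.{v, v} D]

theorem whiskerLeft_heq {X Y Z : C} {f f' : X ⟶ Y} (hf : f = f') {g h g' h' : Y ⟶ Z}
    {η : g ⟶ h} {η' : g' ⟶ h'} (hg : g = g') (hh : h = h') (e : HEq η η') :
    HEq (f ◁ η) (f' ◁ η') := by
  subst hf hg hh; cases e; rfl

theorem whiskerRight_heq {X Y Z : C} {f f' : Y ⟶ Z} (hf : f = f') {g h g' h' : X ⟶ Y}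
    {η : g ⟶ h} {η' : g' ⟶ h'} (hg : g = g') (hh : h = h') (e : HEq η η') :
    HEq (η ▷ f) (η' ▷ f') := by
  subst hf hg hh; cases e; rfl

theorem comp_heq {X Y : C} {f g h f' g' h' : X ⟶ Y} (hf : f = f') (hg : g = g') (hh : h = h')
    {η : f ⟶ g} {θ : g ⟶ h} {η' : f' ⟶ g'} {θ' : g' ⟶ h'} (e : HEq η η') (e' : HEq θ θ') :
    HEq (η ≫ θ) (η' ≫ θ') := by
  subst hf hg hh; cases e; cases e'; rfl

theorem map₂_heq (F : StrictPseudofunctor C D) {X Y : C} {f g f' g' : X ⟶ Y}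
    {η : f ⟶ g} {η' : f' ⟶ g'} (hf : f = f') (hg : g = g') (e : HEq η η') :
    HEq (F.map₂ η) (F.map₂ η') := by
  subst hf hg; cases e; rfl

theorem map₂_whiskerLeft_heq (F : StrictPseudofunctor C D) {X Y Z : C} (f : X ⟶ Y) {g h : Y ⟶ Z}
    (η : g ⟶ h) : HEq (F.map₂ (f ◁ η)) (F.map f ◁ F.map₂ η) := by
  rw [F.map₂_whisker_left]
  simp [F.mapComp_eq_eqToIso]

theorem map₂_whiskerRight_heq (F : StrictPseudofunctor C D) {X Y Z : C} {f g : X ⟶ Y} (η : f ⟶ g)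
    (h : Y ⟶ Z) : HEq (F.map₂ (η ▷ h)) (F.map₂ η ▷ F.map h) := by
  rw [F.map₂_whisker_right]
  simp [F.mapComp_eq_eqToIso]

variable [Strict C]

theorem comp_whiskerLeft_heq {W X Y Z : C} (f : W ⟶ X) (g : X ⟶ Y) {h k : Y ⟶ Z} (η : h ⟶ k) :
    HEq ((f ≫ g) ◁ η) (f ◁ g ◁ η) := by
  rw [comp_whiskerLeft]
  simp [Strict.associator_eqToIso]

theorem whiskerRight_comp_heq {W X Y Z : C} {f g : W ⟶ X} (η : f ⟶ g) (h : X ⟶ Y) (k : Y ⟶ Z) :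
    HEq (η ▷ (h ≫ k)) (η ▷ h ▷ k) := by
  rw [whiskerRight_comp]
  simp [Strict.associator_eqToIso]

theorem whisker_assoc_heq {W X Y Z : C} (f : W ⟶ X) {g h : X ⟶ Y} (η : g ⟶ h) (k : Y ⟶ Z) :
    HEq ((f ◁ η) ▷ k) (f ◁ (η ▷ k)) := by
  rw [whisker_assoc]
  simp [Strict.associator_eqToIso]

end HEqLemmas

section WeightedLimits

variable {J : Type u₃} [Bicategory.{v, v} J]
  {C : Type u₁} [Bicategory.{v, v} C] [Strict C] {D : Type u₂} [Bicategory.{v, v} D] [Strict D]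

/-- A cone with vertex `X` over the 2-functor `F : J → C`, weighted by the 2-functor
`φ : J → Cat`: a 2-natural transformation `φ ⟶ C(X, F -)`. -/
@[ext]
structure WeightedCone (φ : StrictPseudofunctor J Cat.{v, v}) (F : StrictPseudofunctor J C)
    (X : C) where
  leg (j : J) : φ.obj j ⥤ (X ⟶ F.obj j)
  naturality_obj {j k : J} (a : j ⟶ k) (x : φ.obj j) :
    (leg k).obj ((φ.map a).toFunctor.obj x) = (leg j).obj x ≫ F.map a
  naturality_map {j k : J} (a : j ⟶ k) {x y : φ.obj j} (h : x ⟶ y) :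
    HEq ((leg k).map ((φ.map a).toFunctor.map h)) ((leg j).map h ▷ F.map a)
  naturality_two {j k : J} {a b : j ⟶ k} (η : a ⟶ b) (x : φ.obj j) :
    HEq ((leg k).map ((φ.map₂ η).toNatTrans.app x)) ((leg j).obj x ◁ F.map₂ η)

namespace WeightedCone

variable {φ : StrictPseudofunctor J Cat.{v, v}} {F : StrictPseudofunctor J C}

/-- Morphisms of weighted cones with vertex `X`: modifications between 2-natural transformations
`φ ⟶ C(X, F -)`. -/
@[ext]
structure Hom {X : C} (c d : WeightedCone φ F X) where
  app (j : J) : c.leg j ⟶ d.leg j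
  naturality {j k : J} (a : j ⟶ k) (x : φ.obj j) :
    HEq ((app k).app ((φ.map a).toFunctor.obj x)) ((app j).app x ▷ F.map a)

/-- Restriction of a weighted cone along a 1-cell `f` into its vertex. -/
def precomp {L : C} (c : WeightedCone φ F L) {X : C} (f : X ⟶ L) : WeightedCone φ F X where
  leg j := c.leg j ⋙ Bicategory.precomp (F.obj j) f
  naturality_obj a x := by
    simp [c.naturality_obj]
  naturality_map a x y h := by
    refine (whiskerLeft_heq rfl (c.naturality_obj a x) (c.naturality_obj a y)
      (c.naturality_map a h)).trans ?_
    exact (whisker_assoc_heq _ _ _).symm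
  naturality_two {j k a b} η x := by
    have h : (c.leg k).obj ((φ.map b).toFunctor.obj x) = (c.leg j).obj x ≫ F.map b :=
      c.naturality_obj b x
    refine (whiskerLeft_heq rfl (c.naturality_obj a x) h (c.naturality_two η x)).trans ?_
    exact (comp_whiskerLeft_heq _ _ _).symm

/-- Restriction of a weighted cone along a 2-cell `α` between 1-cells into its vertex. -/
def precompHom {L : C} (c : WeightedCone φ F L) {X : C} {f g : X ⟶ L} (α : f ⟶ g) :
    Hom (c.precomp f) (c.precomp g) where
  app j :=
    { app := fun x => α ▷ (c.leg j).obj x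
      naturality := fun _ _ h => whisker_exchange α ((c.leg j).map h) }
  naturality a x := by
    refine (whiskerRight_heq (c.naturality_obj a x) rfl rfl HEq.rfl).trans ?_
    exact whiskerRight_comp_heq _ _ _

/-- A weighted cone `c` with vertex `L` exhibits `L` as the limit `{φ, F}` when restriction of `c`
is an isomorphism of categories from `C(X, L)` to the category of 2-natural transformations
`φ ⟶ C(X, F -)` and modifications, for every `X`. -/
def IsLimit {L : C} (c : WeightedCone φ F L) : Prop :=
  ∀ X : C, Function.Bijective (fun f : X ⟶ L => c.precomp f) ∧
    ∀ f g : X ⟶ L, Function.Bijective (fun α : f ⟶ g => c.precompHom α)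

/-- The image of a weighted cone under a 2-functor. -/
def map {L : C} (c : WeightedCone φ F L) (W : StrictPseudofunctor C D) :
    WeightedCone φ (F.comp W) (W.obj L) where
  leg j := c.leg j ⋙ W.mapFunctor L (F.obj j)
  naturality_obj a x :=
    (congrArg W.map (c.naturality_obj a x)).trans (W.map_comp _ _)
  naturality_map a x y h := by
    refine (map₂_heq W (c.naturality_obj a x) (c.naturality_obj a y)
      (c.naturality_map a h)).trans ?_
    exact map₂_whiskerRight_heq W _ _
  naturality_two {j k a b} η x := by
    have h : (c.leg k).obj ((φ.map b).toFunctor.obj x) = (c.leg j).obj x ≫ F.map b :=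
      c.naturality_obj b x
    refine (map₂_heq W (c.naturality_obj a x) h (c.naturality_two η x)).trans ?_
    exact map₂_whiskerLeft_heq W _ _

end WeightedCone

/-- A `V`-category is complete when it has all small `V`-weighted limits: the limit `{φ, F}` for
all small `V`-categories `J` and all `V`-functors `φ : J → V` and `F : J → C`. -/
def IsVComplete (V : ObjectProperty Cat.{v, v}) (C : Type u) [Bicategory.{v, v} C] [Strict C] :
    Prop :=
  ∀ (J : Type v) [Bicategory.{v, v} J] [Strict J], IsVCategory V J →
    ∀ (φ : StrictPseudofunctor J Cat.{v, v}), (∀ j, V (φ.obj j)) →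
    ∀ (F : StrictPseudofunctor J C), ∃ (L : C) (c : WeightedCone φ F L), c.IsLimit

/-- A `V`-functor is continuous when it preserves all small `V`-weighted limits. -/
def IsVContinuous (V : ObjectProperty Cat.{v, v}) (W : StrictPseudofunctor C D) : Prop :=
  ∀ (J : Type v) [Bicategory.{v, v} J] [Strict J], IsVCategory V J →
    ∀ (φ : StrictPseudofunctor J Cat.{v, v}), (∀ j, V (φ.obj j)) →
    ∀ (F : StrictPseudofunctor J C) (L : C) (c : WeightedCone φ F L),
      c.IsLimit → (c.map W).IsLimit

end WeightedLimits

/-- A 2-monad `(T, i, m)` on a 2-category: a 2-functor `T` with 2-natural transformations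
`i : 1 ⟶ T` and `m : T T ⟶ T` that satisfy the unit and associativity laws. -/
structure TwoMonad (C : Type u) [Bicategory.{v, v} C] [Strict C] where
  T : StrictPseudofunctor C C
  i (X : C) : X ⟶ T.obj X
  i_naturality {X Y : C} (f : X ⟶ Y) : f ≫ i Y = i X ≫ T.map f
  i_naturality_two {X Y : C} {f g : X ⟶ Y} (α : f ⟶ g) : HEq (α ▷ i Y) (i X ◁ T.map₂ α)
  m (X : C) : T.obj (T.obj X) ⟶ T.obj X
  m_naturality {X Y : C} (f : X ⟶ Y) : T.map (T.map f) ≫ m Y = m X ≫ T.map f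
  m_naturality_two {X Y : C} {f g : X ⟶ Y} (α : f ⟶ g) :
    HEq (T.map₂ (T.map₂ α) ▷ m Y) (m X ◁ T.map₂ α)
  i_m (X : C) : i (T.obj X) ≫ m X = 𝟙 (T.obj X)
  map_i_m (X : C) : T.map (i X) ≫ m X = 𝟙 (T.obj X)
  m_m (X : C) : m (T.obj X) ≫ m X = T.map (m X) ≫ m X

namespace TwoMonad

variable {C : Type u} [Bicategory.{v, v} C] [Strict C]

/-- A 2-monad is lax idempotent when there is a modification `δ` from `T i` to `i T` such that
`m · δ = 1` and `δ · i = 1`. -/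
def IsLaxIdempotent (M : TwoMonad C) : Prop :=
  ∃ δ : ∀ X : C, M.T.map (M.i X) ⟶ M.i (M.T.obj X),
    (∀ {X Y : C} (f : X ⟶ Y), HEq (δ X ▷ M.T.map (M.T.map f)) (M.T.map f ◁ δ Y)) ∧
    (∀ X : C, HEq (δ X ▷ M.m X) (𝟙 (𝟙 (M.T.obj X)))) ∧
    (∀ X : C, HEq (M.i X ◁ δ X) (𝟙 (M.i X ≫ M.i (M.T.obj X))))

/-- (Strict) algebras for a 2-monad. -/
structure Algebra (M : TwoMonad C) where
  carrier : C
  str : M.T.obj carrier ⟶ carrier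
  unit : M.i carrier ≫ str = 𝟙 carrier
  assoc : M.m carrier ≫ str = M.T.map str ≫ str

namespace Algebra

variable {M : TwoMonad C}

/-- (Strict) morphisms of algebras. -/
@[ext]
structure Hom (A B : M.Algebra) where
  hom : A.carrier ⟶ B.carrier
  comm : M.T.map hom ≫ B.str = A.str ≫ hom

/-- 2-cells between morphisms of algebras: 2-cells `α` such that `b · T α = α · a`. -/
@[ext]
structure Hom₂ {A B : M.Algebra} (f g : Hom A B) where
  cell : f.hom ⟶ g.hom
  comm : HEq (M.T.map₂ cell ▷ B.str) (A.str ◁ cell)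

/-- The identity morphism of an algebra. -/
def Hom.id (A : M.Algebra) : Hom A A where
  hom := 𝟙 A.carrier
  comm := by rw [M.T.map_id, Strict.id_comp, Strict.comp_id]

/-- Composition of morphisms of algebras. -/
def Hom.comp {A B D : M.Algebra} (f : Hom A B) (g : Hom B D) : Hom A D where
  hom := f.hom ≫ g.hom
  comm := by
    rw [M.T.map_comp, Strict.assoc, g.comm, ← Strict.assoc, f.comm, Strict.assoc]

instance : CategoryStruct (M.Algebra) where
  Hom := Hom
  id := Hom.id
  comp := Hom.comp

instance (A B : M.Algebra) : Category.{v} (A ⟶ B) where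
  Hom f g := Hom₂ f g
  id f := ⟨𝟙 f.hom, by
    have h := f.comm
    rw [M.T.map₂_id, id_whiskerRight, whiskerLeft_id, h]⟩
  comp {f g h} α β := ⟨α.cell ≫ β.cell, by
    rw [M.T.map₂_comp, comp_whiskerRight, whiskerLeft_comp]
    exact comp_heq f.comm g.comm h.comm α.comm β.comm⟩
  id_comp α := Hom₂.ext (Category.id_comp α.cell)
  comp_id α := Hom₂.ext (Category.comp_id α.cell)
  assoc α β γ := Hom₂.ext (Category.assoc α.cell β.cell γ.cell)

@[simp] theorem id_hom (A : M.Algebra) : Hom.hom (𝟙 A) = 𝟙 A.carrier := rfl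

@[simp] theorem comp_hom {A B D : M.Algebra} (f : A ⟶ B) (g : B ⟶ D) :
    Hom.hom (f ≫ g) = Hom.hom f ≫ Hom.hom g := rfl

@[simp] theorem id_cell {A B : M.Algebra} (f : A ⟶ B) :
    Hom₂.cell (𝟙 f) = 𝟙 (Hom.hom f) := rfl

@[simp] theorem comp_cell {A B : M.Algebra} {f g h : A ⟶ B} (α : f ⟶ g) (β : g ⟶ h) :
    Hom₂.cell (α ≫ β) = Hom₂.cell α ≫ Hom₂.cell β := rfl

@[ext] theorem hom_ext {A B : M.Algebra} {f g : A ⟶ B} (h : Hom.hom f = Hom.hom g) : f = g :=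
  Hom.ext h

@[ext] theorem cell_ext {A B : M.Algebra} {f g : A ⟶ B} {α β : f ⟶ g}
    (h : Hom₂.cell α = Hom₂.cell β) : α = β :=
  Hom₂.ext h

@[simp] theorem eqToHom_cell {A B : M.Algebra} {f g : A ⟶ B} (h : f = g) :
    Hom₂.cell (eqToHom h) = eqToHom (congrArg Hom.hom h) := by
  subst h; rfl

/-- Whiskering of 2-cells of algebras. -/
def cellWhiskerLeft {A B D : M.Algebra} (f : A ⟶ B) {g h : B ⟶ D} (η : g ⟶ h) :
    f ≫ g ⟶ f ≫ h where
  cell := Hom.hom f ◁ Hom₂.cell η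
  comm := by
    have hf := Hom.comm f
    have hg := Hom.comm g
    have hh := Hom.comm h
    have e := Hom₂.comm η
    refine (whiskerRight_heq rfl (M.T.map_comp _ _) (M.T.map_comp _ _)
      (map₂_whiskerLeft_heq M.T _ _)).trans ?_
    refine (whisker_assoc_heq _ _ _).trans ?_
    refine (whiskerLeft_heq rfl hg hh e).trans ?_
    refine (comp_whiskerLeft_heq _ _ _).symm.trans ?_
    refine (whiskerLeft_heq hf rfl rfl HEq.rfl).trans ?_
    exact comp_whiskerLeft_heq _ _ _

/-- Whiskering of 2-cells of algebras. -/
def cellWhiskerRight {A B D : M.Algebra} {f g : A ⟶ B} (η : f ⟶ g) (h : B ⟶ D) :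
    f ≫ h ⟶ g ≫ h where
  cell := Hom₂.cell η ▷ Hom.hom h
  comm := by
    have hf := Hom.comm f
    have hg := Hom.comm g
    have hh := Hom.comm h
    have e := Hom₂.comm η
    refine (whiskerRight_heq rfl (M.T.map_comp _ _) (M.T.map_comp _ _)
      (map₂_whiskerRight_heq M.T _ _)).trans ?_
    refine (whiskerRight_comp_heq _ _ _).symm.trans ?_
    refine (whiskerRight_heq hh rfl rfl HEq.rfl).trans ?_
    refine (whiskerRight_comp_heq _ _ _).trans ?_
    refine (whiskerRight_heq rfl hf hg e).trans ?_
    exact whisker_assoc_heq _ _ _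

/-- The 2-category `T-Alg` of algebras, (strict) morphisms and 2-cells. -/
instance : Bicategory.{v, v} (M.Algebra) where
  whiskerLeft f _ _ η := cellWhiskerLeft f η
  whiskerRight η h := cellWhiskerRight η h
  associator f g h := eqToIso (hom_ext (Strict.assoc _ _ _))
  leftUnitor f := eqToIso (hom_ext (Strict.id_comp _))
  rightUnitor f := eqToIso (hom_ext (Strict.comp_id _))
  whiskerLeft_id f g := cell_ext (whiskerLeft_id _ _)
  whiskerLeft_comp f _ _ _ η θ := cell_ext (whiskerLeft_comp _ _ _)
  id_whiskerLeft η := by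
    apply cell_ext
    simp [cellWhiskerLeft, Strict.leftUnitor_eqToIso]
  comp_whiskerLeft f g _ _ η := by
    apply cell_ext
    simp [cellWhiskerLeft, Strict.associator_eqToIso]
  id_whiskerRight f g := cell_ext (id_whiskerRight _ _)
  comp_whiskerRight η θ i := cell_ext (comp_whiskerRight _ _ _)
  whiskerRight_id η := by
    apply cell_ext
    simp [cellWhiskerRight, Strict.rightUnitor_eqToIso]
  whiskerRight_comp η g h := by
    apply cell_ext
    simp [cellWhiskerRight, Strict.associator_eqToIso]
  whisker_assoc f _ _ η h := by
    apply cell_ext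
    simp [cellWhiskerLeft, cellWhiskerRight, Strict.associator_eqToIso]
  whisker_exchange η θ := cell_ext (whisker_exchange _ _)
  pentagon f g h i := by
    apply cell_ext
    simp only [cellWhiskerLeft, cellWhiskerRight, eqToIso.hom, comp_cell, eqToHom_cell]
    erw [eqToHom_whiskerRight, whiskerLeft_eqToHom]
    erw [eqToHom_trans, eqToHom_trans, eqToHom_trans]
  triangle f g := by
    apply cell_ext
    simp only [cellWhiskerLeft, cellWhiskerRight, eqToIso.hom, comp_cell, eqToHom_cell]
    erw [eqToHom_whiskerRight, whiskerLeft_eqToHom, eqToHom_trans]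
    rfl

instance : Strict (M.Algebra) where
  id_comp f := hom_ext (Strict.id_comp _)
  comp_id f := hom_ext (Strict.comp_id _)
  assoc f g h := hom_ext (Strict.assoc _ _ _)

end Algebra

/-- The forgetful 2-functor `T-Alg → C`. -/
def forget (M : TwoMonad C) : StrictPseudofunctor M.Algebra C :=
  StrictPseudofunctor.mk''
    { obj := fun A => A.carrier
      map := fun f => Algebra.Hom.hom f
      map₂ := fun α => Algebra.Hom₂.cell α
      map₂_whisker_left := fun f _ _ η => by
        change _ = 𝟙 _ ≫ (Algebra.Hom.hom f ◁ Algebra.Hom₂.cell η) ≫ 𝟙 _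
        rw [Category.id_comp, Category.comp_id]
        rfl
      map₂_whisker_right := fun η g => by
        change _ = 𝟙 _ ≫ (Algebra.Hom₂.cell η ▷ Algebra.Hom.hom g) ≫ 𝟙 _
        rw [Category.id_comp, Category.comp_id]
        rfl }

end TwoMonad

/-- A square of 2-functors
```
  A --Q--> D
  |        |
  P        R
  v        v
  C --W--> B
```
is a pullback: it commutes, and the comparison of `A` with the 2-category of compatible pairs of
objects, 1-cells and 2-cells of `C` and `D` is bijective on objects, on 1-cells and on 2-cells. -/
structure IsPullbackSquare {A : Type u₁} {C : Type u₂} {D : Type u₃} {B : Type u₄}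
    [Bicategory.{v, v} A] [Bicategory.{v, v} C] [Bicategory.{v, v} D] [Bicategory.{v, v} B]
    (P : StrictPseudofunctor A C) (Q : StrictPseudofunctor A D)
    (W : StrictPseudofunctor C B) (R : StrictPseudofunctor D B) : Prop where
  comm : P.comp W = Q.comp R
  lift_obj (c : C) (d : D) : W.obj c = R.obj d → ∃! a : A, P.obj a = c ∧ Q.obj a = d
  lift_map {a a' : A} (f : P.obj a ⟶ P.obj a') (g : Q.obj a ⟶ Q.obj a') :
    HEq (W.map f) (R.map g) → ∃! h : a ⟶ a', P.map h = f ∧ Q.map h = g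
  lift_map₂ {a a' : A} {h k : a ⟶ a'} (α : P.map h ⟶ P.map k) (β : Q.map h ⟶ Q.map k) :
    HEq (W.map₂ α) (R.map₂ β) → ∃! γ : h ⟶ k, P.map₂ γ = α ∧ Q.map₂ γ = β

end LaxIdem

/-! Lax idempotency can be recognised from lifting lax limits of arbitrary, not necessarily strict,
1-cells `f : A ⟶ B` between carriers of algebras. The condition is that the lax limit `L` carries an
algebra structure for which a 1-cell into `L` is strict exactly when its two projections, to `A` and
to `B`, are.

If the monad is lax idempotent, `δ` makes `f` a lax morphism, and the structure on `L` comes from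
pasting that lax cell to the image of the limit cell (`LaxIdempotency.exists_algebra`). The algebra
laws and the detection of strictness hold because a 2-cell out of a free algebra with strict source
is determined by its boundary and its restriction along the unit (`LaxIdempotency.cell_ext`).

Conversely, let `L` lift in this way with `A = TX` free. The identity 2-cell of `f` gives a section
`TX ⟶ L`; extending its restriction to generators to a strict 1-cell and composing with the limit
cell gives a counit, from the strict extension of `f` on generators to `f`. For `f = i_{TX}` this is
a cell `T i_X ⟹ i_{TX}`, and its naturality yields the axioms of `δ` (`nonempty_laxIdempotency`).

The lifting condition passes from `S` to `T`: `W` preserves the lax limit, `S` lifts its image, and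
the pullback supplies an algebra on `L` itself and detects strictness. -/

namespace LaxIdem

/-! ### Calculus of bundled 2-cells, and lax limits of 1-cells. -/

section Cells

variable {C : Type u₁} [Bicategory.{v, v} C] {D : Type u₂} [Bicategory.{v, v} D]

/-- A 2-cell bundled with its source and target.  Equations between bundled 2-cells of a
2-category do not depend on the associativity and unit equations between 1-cells. -/
structure Cell (X Y : C) where
  src : X ⟶ Y
  tgt : X ⟶ Y
  hom : src ⟶ tgt

namespace Cell

theorem mk_eq {X Y : C} {f g f' g' : X ⟶ Y} {α : f ⟶ g} {β : f' ⟶ g'} (hf : f = f') (hg : g = g')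
    (h : HEq α β) : Cell.mk f g α = Cell.mk f' g' β := by
  subst hf hg; cases h; rfl

theorem heq_of_eq {X Y : C} {f g f' g' : X ⟶ Y} {α : f ⟶ g} {β : f' ⟶ g'}
    (h : Cell.mk f g α = Cell.mk f' g' β) : HEq α β := by
  cases h; rfl

theorem exists_hom {X Y : C} (c : Cell X Y) {f g : X ⟶ Y} (hf : c.src = f) (hg : c.tgt = g) :
    ∃ α : f ⟶ g, Cell.mk f g α = c := by
  subst hf hg; exact ⟨c.hom, rfl⟩

/-- The identity 2-cell. -/
abbrev idc {X Y : C} (f : X ⟶ Y) : Cell X Y := ⟨f, f, 𝟙 f⟩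

/-- Left whiskering. -/
abbrev wl {X Y Z : C} (f : X ⟶ Y) (c : Cell Y Z) : Cell X Z := ⟨f ≫ c.src, f ≫ c.tgt, f ◁ c.hom⟩

/-- Right whiskering. -/
abbrev wr {X Y Z : C} (c : Cell X Y) (g : Y ⟶ Z) : Cell X Z := ⟨c.src ≫ g, c.tgt ≫ g, c.hom ▷ g⟩

/-- Vertical composition. -/
abbrev vcomp {X Y : C} (c d : Cell X Y) (h : c.tgt = d.src) : Cell X Y :=
  ⟨c.src, d.tgt, c.hom ≫ eqToHom h ≫ d.hom⟩

/-- The image of a bundled 2-cell under a 2-functor. -/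
abbrev map (F : StrictPseudofunctor C D) {X Y : C} (c : Cell X Y) : Cell (F.obj X) (F.obj Y) :=
  ⟨F.map c.src, F.map c.tgt, F.map₂ c.hom⟩

theorem wl_idc {X Y Z : C} (f : X ⟶ Y) (g : Y ⟶ Z) : wl f (idc g) = idc (f ≫ g) := by
  simp [wl, idc]

theorem idc_wr {X Y Z : C} (f : X ⟶ Y) (g : Y ⟶ Z) : wr (idc f) g = idc (f ≫ g) := by
  simp [wr, idc]

theorem vcomp_congr {X Y : C} {c d c' d' : Cell X Y} {h : c.tgt = d.src} (hc : c = c')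
    (hd : d = d') : vcomp c d h = vcomp c' d' (by rw [← hc, ← hd, h]) := by
  subst hc hd; rfl

theorem vcomp_idc {X Y : C} (c : Cell X Y) (f : X ⟶ Y) (h : c.tgt = f) :
    vcomp c (idc f) h = c := by
  subst h; simp [vcomp, idc]

theorem idc_vcomp {X Y : C} (c : Cell X Y) (f : X ⟶ Y) (h : f = c.src) :
    vcomp (idc f) c h = c := by
  subst h; simp [vcomp, idc]

theorem wl_vcomp {X Y Z : C} (f : X ⟶ Y) (c d : Cell Y Z) (h : c.tgt = d.src) :
    wl f (vcomp c d h) = vcomp (wl f c) (wl f d) (congrArg (f ≫ ·) h) := by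
  simp [wl, vcomp]

theorem map_wl (F : StrictPseudofunctor C D) {X Y Z : C} (f : X ⟶ Y) (c : Cell Y Z) :
    map F (wl f c) = wl (F.map f) (map F c) :=
  mk_eq (F.map_comp _ _) (F.map_comp _ _) (map₂_whiskerLeft_heq F f c.hom)

/-- The interchange law. -/
theorem exchange {X Y Z : C} (c : Cell X Y) (d : Cell Y Z) :
    vcomp (wl c.src d) (wr c d.tgt) rfl = vcomp (wr c d.src) (wl c.tgt d) rfl := by
  simp [vcomp, wl, wr, whisker_exchange]

variable [Strict C]

theorem wl_wl {W X Y Z : C} (f : W ⟶ X) (g : X ⟶ Y) (c : Cell Y Z) :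
    wl f (wl g c) = wl (f ≫ g) c :=
  (mk_eq (Strict.assoc _ _ _) (Strict.assoc _ _ _) (comp_whiskerLeft_heq f g c.hom)).symm

theorem wr_wr {W X Y Z : C} (c : Cell W X) (g : X ⟶ Y) (h : Y ⟶ Z) :
    wr (wr c g) h = wr c (g ≫ h) :=
  mk_eq (Strict.assoc _ _ _) (Strict.assoc _ _ _) (whiskerRight_comp_heq c.hom g h).symm

theorem wl_wr {W X Y Z : C} (f : W ⟶ X) (c : Cell X Y) (g : Y ⟶ Z) :
    wr (wl f c) g = wl f (wr c g) :=
  mk_eq (Strict.assoc _ _ _) (Strict.assoc _ _ _) (whisker_assoc_heq f c.hom g)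

theorem id_wl {X Y : C} (c : Cell X Y) : wl (𝟙 X) c = c := by
  refine mk_eq (Strict.id_comp _) (Strict.id_comp _) ?_
  rw [id_whiskerLeft]
  simp [Strict.leftUnitor_eqToIso]

theorem wr_id {X Y : C} (c : Cell X Y) : wr c (𝟙 Y) = c := by
  refine mk_eq (Strict.comp_id _) (Strict.comp_id _) ?_
  rw [whiskerRight_id]
  simp [Strict.rightUnitor_eqToIso]

end Cell

/-- The bundled 2-cell `c` exhibits `L`, with the projection `p` to `A`, as the lax limit of the
1-cell `f`: every 2-cell into `B` whose target factors through `f` factors uniquely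
through `c`. -/
structure IsLaxLimit {A B L : C} (f : A ⟶ B) (p : L ⟶ A) (c : Cell L B) : Prop where
  tgt : c.tgt = p ≫ f
  existsUnique {Z : C} (x : Z ⟶ A) (d : Cell Z B) : d.tgt = x ≫ f →
    ∃! y : Z ⟶ L, y ≫ p = x ∧ c.wl y = d

theorem IsLaxLimit.hom_ext [Strict C] {A B L : C} {f : A ⟶ B} {p : L ⟶ A} {c : Cell L B}
    (h : IsLaxLimit f p c) {Z : C} {y z : Z ⟶ L} (hp : y ≫ p = z ≫ p) (hc : c.wl y = c.wl z) :
    y = z := by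
  refine (h.existsUnique (z ≫ p) (c.wl z) ?_).unique ⟨hp, hc⟩ ⟨rfl, rfl⟩
  change z ≫ c.tgt = _
  rw [h.tgt, Strict.assoc]

end Cells

/-! ### Strict 1-cells and free algebras. -/

namespace TwoMonad

open Cell

variable {C : Type u} [Bicategory.{v, v} C] [Strict C] (M : TwoMonad C)

theorem wr_i {X Y : C} (c : Cell X Y) : wr c (M.i Y) = wl (M.i X) (map M.T c) :=
  mk_eq (M.i_naturality _) (M.i_naturality _) (M.i_naturality_two c.hom)

theorem wr_m {X Y : C} (c : Cell X Y) : wr (map M.T (map M.T c)) (M.m Y) = wl (M.m X) (map M.T c) :=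
  mk_eq (M.m_naturality _) (M.m_naturality _) (M.m_naturality_two c.hom)

/-- The data of a lax idempotent 2-monad, in terms of bundled 2-cells. -/
structure LaxIdempotency where
  δ (X : C) : Cell (M.T.obj X) (M.T.obj (M.T.obj X))
  src (X : C) : (δ X).src = M.T.map (M.i X)
  tgt (X : C) : (δ X).tgt = M.i (M.T.obj X)
  naturality {X Y : C} (f : X ⟶ Y) : wr (δ X) (M.T.map (M.T.map f)) = wl (M.T.map f) (δ Y)
  wr_m (X : C) : wr (δ X) (M.m X) = idc (𝟙 (M.T.obj X))
  i_wl (X : C) : wl (M.i X) (δ X) = idc (M.i X ≫ M.i (M.T.obj X))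

theorem isLaxIdempotent_iff : M.IsLaxIdempotent ↔ Nonempty M.LaxIdempotency := by
  constructor
  · rintro ⟨δ, h₁, h₂, h₃⟩
    refine ⟨⟨fun X => ⟨_, _, δ X⟩, fun X => rfl, fun X => rfl, fun f => mk_eq ?_ ?_ (h₁ f),
      fun X => mk_eq (M.map_i_m X) (M.i_m X) (h₂ X),
      fun X => mk_eq (M.i_naturality _).symm rfl (h₃ X)⟩⟩
    · rw [← M.T.map_comp, ← M.T.map_comp, M.i_naturality]
    · rw [M.i_naturality]
  · rintro ⟨δ, hs, ht, h₁, h₂, h₃⟩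
    choose d hd using fun X => exists_hom (δ X) (hs X) (ht X)
    obtain rfl : (fun X => ⟨_, _, d X⟩) = δ := funext hd
    exact ⟨d, fun f => heq_of_eq (h₁ f), fun X => heq_of_eq (h₂ X), fun X => heq_of_eq (h₃ X)⟩

variable {M}

/-- A 1-cell between the carriers of algebras is strict when it is a morphism of algebras. -/
def IsStrict (A B : M.Algebra) (f : A.carrier ⟶ B.carrier) : Prop :=
  M.T.map f ≫ B.str = A.str ≫ f

theorem IsStrict.comp {A B D : M.Algebra} {f : A.carrier ⟶ B.carrier} {g : B.carrier ⟶ D.carrier}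
    (hf : IsStrict A B f) (hg : IsStrict B D g) : IsStrict A D (f ≫ g) := by
  unfold IsStrict at *
  rw [M.T.map_comp, Strict.assoc, hg, ← Strict.assoc, hf, Strict.assoc]

theorem isStrict_id (A : M.Algebra) : IsStrict A A (𝟙 A.carrier) := by
  unfold IsStrict
  rw [M.T.map_id, Strict.id_comp, Strict.comp_id]

variable (M) in
/-- The free algebra. -/
abbrev free (X : C) : M.Algebra where
  carrier := M.T.obj X
  str := M.m X
  unit := M.i_m X
  assoc := M.m_m X

theorem isStrict_free_map {X Y : C} (f : X ⟶ Y) : IsStrict (M.free X) (M.free Y) (M.T.map f) :=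
  M.m_naturality f

theorem isStrict_str (A : M.Algebra) : IsStrict (M.free A.carrier) A A.str :=
  A.assoc.symm

theorem IsStrict.eq_extend {X : C} {A : M.Algebra} {f : M.T.obj X ⟶ A.carrier}
    (hf : IsStrict (M.free X) A f) : M.T.map (M.i X ≫ f) ≫ A.str = f := by
  have h : M.T.map f ≫ A.str = M.m X ≫ f := hf
  rw [M.T.map_comp, Strict.assoc, h, ← Strict.assoc, M.map_i_m, Strict.id_comp]

/-- Freeness of `TX`: a strict 1-cell is the extension of its restriction to generators. -/
theorem IsStrict.hom_ext {X : C} {A : M.Algebra} {f g : M.T.obj X ⟶ A.carrier}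
    (hf : IsStrict (M.free X) A f) (hg : IsStrict (M.free X) A g)
    (h : M.i X ≫ f = M.i X ≫ g) : f = g := by
  rw [← hf.eq_extend, h, hg.eq_extend]

theorem isStrict_extend {X : C} {A : M.Algebra} (f : X ⟶ A.carrier) :
    IsStrict (M.free X) A (M.T.map f ≫ A.str) :=
  (isStrict_free_map f).comp (isStrict_str A)

theorem i_extend {X : C} {A : M.Algebra} (f : X ⟶ A.carrier) :
    M.i X ≫ M.T.map f ≫ A.str = f := by
  rw [← Strict.assoc, ← M.i_naturality, Strict.assoc, A.unit, Strict.comp_id]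

/-! ### Lifting lax limits along a lax idempotent monad. -/

namespace LaxIdempotency

variable (hM : M.LaxIdempotency)
include hM

/-- Under lax idempotency, 2-cells out of a strict 1-cell are determined by their restriction
along the unit. -/
theorem cell_ext {X : C} {B : M.Algebra} {α β : Cell (M.T.obj X) B.carrier}
    (hs : IsStrict (M.free X) B α.src) (hsrc : α.src = β.src) (htgt : α.tgt = β.tgt)
    (h : wl (M.i X) α = wl (M.i X) β) : α = β := by
  -- Interchange of `δ_X` with `b · Tγ` reconstructs `γ` from its restriction to generators and its
  -- target. One side of the interchange is this reconstruction. On the other, strictness of the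
  -- source turns the `δ` factor into `m · δ = 1`, and the remaining factor is `γ` by naturality of
  -- `i`.
  have key (γ : Cell (M.T.obj X) B.carrier) (hγ : IsStrict (M.free X) B γ.src) :
      vcomp (wr (map M.T (wl (M.i X) γ)) B.str) (wr (hM.δ X) (M.T.map γ.tgt ≫ B.str))
        (by simp [hM.src, M.T.map_comp]) = γ := by
    have hx := exchange (hM.δ X) (wr (map M.T γ) B.str)
    have h₁ : wl (hM.δ X).src (wr (map M.T γ) B.str) = wr (map M.T (wl (M.i X) γ)) B.str := by
      rw [hM.src, map_wl, wl_wr]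
    have h₂ : wr (hM.δ X) (wr (map M.T γ) B.str).src = idc γ.src := by
      change wr (hM.δ X) (M.T.map γ.src ≫ B.str) = _
      rw [show M.T.map γ.src ≫ B.str = M.m X ≫ γ.src from hγ, ← wr_wr, hM.wr_m, idc_wr,
        Strict.id_comp]
    have h₃ : wl (hM.δ X).tgt (wr (map M.T γ) B.str) = γ := by
      rw [hM.tgt, ← wl_wr, ← wr_i, wr_wr, B.unit, wr_id]
    rw [vcomp_congr h₁ rfl, vcomp_congr h₂ h₃, idc_vcomp] at hx
    exact hx
  have hk := key α hs
  rw [← hk, ← key β (hsrc ▸ hs)]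
  congr 1 <;> simp only [h, htgt]

/-- The unique lax structure on a 1-cell between the carriers of algebras. -/
def laxCell {A B : M.Algebra} (f : A.carrier ⟶ B.carrier) : Cell (M.T.obj A.carrier) B.carrier :=
  wr (hM.δ A.carrier) (M.T.map A.str ≫ M.T.map f ≫ B.str)

theorem laxCell_src {A B : M.Algebra} (f : A.carrier ⟶ B.carrier) :
    (hM.laxCell f).src = M.T.map f ≫ B.str := by
  change (hM.δ _).src ≫ _ = _
  rw [hM.src, ← Strict.assoc, ← M.T.map_comp, A.unit, M.T.map_id, Strict.id_comp]

theorem laxCell_tgt {A B : M.Algebra} (f : A.carrier ⟶ B.carrier) :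
    (hM.laxCell f).tgt = A.str ≫ f := by
  change (hM.δ _).tgt ≫ _ = _
  rw [hM.tgt, ← Strict.assoc, ← M.i_naturality, Strict.assoc, i_extend]

theorem i_laxCell {A B : M.Algebra} (f : A.carrier ⟶ B.carrier) :
    wl (M.i A.carrier) (hM.laxCell f) = idc f := by
  unfold laxCell
  rw [← wl_wr, hM.i_wl, idc_wr, ← Strict.assoc, Strict.assoc (M.i _), ← M.i_naturality,
    ← Strict.assoc (M.i _), A.unit, Strict.id_comp, i_extend]

/-- Only the source projection has to be strict: the target `y ≫ p ≫ f` need not be, because `f` is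
arbitrary. -/
theorem hom_ext_of_isLaxLimit {A B : M.Algebra} {f : A.carrier ⟶ B.carrier} {L : C}
    {p : L ⟶ A.carrier} {c : Cell L B.carrier} (hc : IsLaxLimit f p c) {X : C}
    {y z : M.T.obj X ⟶ L} (hp : y ≫ p = z ≫ p) (hq : y ≫ c.src = z ≫ c.src)
    (hs : IsStrict (M.free X) B (y ≫ c.src)) (hi : M.i X ≫ y = M.i X ≫ z) : y = z := by
  refine hc.hom_ext hp (hM.cell_ext hs hq ?_ ?_)
  · change y ≫ c.tgt = z ≫ c.tgt
    rw [hc.tgt, ← Strict.assoc, hp, Strict.assoc]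
  · rw [wl_wl, wl_wl, hi]

/-- Lax limits of 1-cells between the carriers of algebras lift to algebras, in such a way that
1-cells into them are strict as soon as their projections are. -/
theorem exists_algebra {A B : M.Algebra} {f : A.carrier ⟶ B.carrier} {L : C}
    {p : L ⟶ A.carrier} {c : Cell L B.carrier} (hc : IsLaxLimit f p c) :
    ∃ (l : M.T.obj L ⟶ L) (hu : M.i L ≫ l = 𝟙 L) (ha : M.m L ≫ l = M.T.map l ≫ l),
      ∀ (D : M.Algebra) (x : D.carrier ⟶ L), IsStrict D ⟨L, l, hu, ha⟩ x ↔
        IsStrict D A (x ≫ p) ∧ IsStrict D B (x ≫ c.src) := by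
  -- With `q` the source of `c`, the structure `l` corresponds to the pasting `b · Tq ⟹ b · Tf · Tp
  -- ⟹ f · a · Tp` of `Tc` with the lax cell of `f`. Hence `p` and `q` are strict by construction.
  have hcomp : (wr (map M.T c) B.str).tgt = (wl (M.T.map p) (hM.laxCell f)).src := by
    simp [laxCell_src, hc.tgt, M.T.map_comp]
  obtain ⟨l, ⟨hlp, hlc⟩, -⟩ := hc.existsUnique (M.T.map p ≫ A.str)
    (vcomp (wr (map M.T c) B.str) (wl (M.T.map p) (hM.laxCell f)) hcomp)
    (by simp [laxCell_tgt])
  have hls : l ≫ c.src = M.T.map c.src ≫ B.str := congrArg Cell.src hlc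
  have hu : M.i L ≫ l = 𝟙 L := by
    refine hc.hom_ext ?_ ?_
    · rw [Strict.assoc, hlp, i_extend, Strict.id_comp]
    · have h₁ : wl (M.i L) (wr (map M.T c) B.str) = c := by
        rw [← wl_wr, ← wr_i, wr_wr, B.unit, wr_id]
      have h₂ : wl (M.i L) (wl (M.T.map p) (hM.laxCell f)) = idc (p ≫ f) := by
        rw [wl_wl, ← M.i_naturality, ← wl_wl, i_laxCell, wl_idc]
      rw [← wl_wl, hlc, wl_vcomp, vcomp_congr h₁ h₂, vcomp_idc, id_wl]
  have hTl {Z : C} (x : Z ⟶ L) : (M.T.map x ≫ l) ≫ p = M.T.map (x ≫ p) ≫ A.str ∧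
      (M.T.map x ≫ l) ≫ c.src = M.T.map (x ≫ c.src) ≫ B.str := by
    rw [Strict.assoc, Strict.assoc, hlp, hls, M.T.map_comp, M.T.map_comp, Strict.assoc,
      Strict.assoc]
    exact ⟨rfl, rfl⟩
  -- Both sides are 1-cells out of the free algebra on `TL`, so it suffices to compare projections
  -- and restrictions along the unit.
  have ha : M.m L ≫ l = M.T.map l ≫ l := by
    refine hM.hom_ext_of_isLaxLimit hc ?_ ?_ ?_ ?_
    · rw [(hTl l).1, hlp, Strict.assoc, hlp, M.T.map_comp, Strict.assoc, ← A.assoc,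
        ← Strict.assoc, ← Strict.assoc, M.m_naturality]
    · rw [(hTl l).2, hls, Strict.assoc, hls, M.T.map_comp, Strict.assoc, ← B.assoc,
        ← Strict.assoc, ← Strict.assoc, M.m_naturality]
    · rw [Strict.assoc, hls]
      exact (isStrict_str (M.free L)).comp (isStrict_extend _)
    · rw [← Strict.assoc, M.i_m, ← Strict.assoc, ← M.i_naturality, Strict.assoc, hu,
        Strict.id_comp, Strict.comp_id]
  refine ⟨l, hu, ha, fun D x => ⟨fun hx => ⟨?_, ?_⟩, fun ⟨hxp, hxq⟩ => ?_⟩⟩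
  · exact hx.comp (B := ⟨L, l, hu, ha⟩) hlp.symm
  · exact hx.comp (B := ⟨L, l, hu, ha⟩) hls.symm
  -- The two sides have equal projections by hypothesis, and both restrict to `x` along the unit of
  -- `D`.
  · change M.T.map x ≫ l = D.str ≫ x
    refine hM.hom_ext_of_isLaxLimit hc ?_ ?_ ?_ ?_
    · rw [(hTl x).1, hxp, Strict.assoc]
    · rw [(hTl x).2, hxq, Strict.assoc]
    · rw [(hTl x).2]
      exact isStrict_extend _
    · rw [← Strict.assoc, ← M.i_naturality, Strict.assoc, hu, Strict.comp_id, ← Strict.assoc,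
        D.unit, Strict.id_comp]

end LaxIdempotency

/-- A lax limit of a 1-cell `f` between the carriers of algebras which is itself an algebra, in
such a way that 1-cells into it are strict as soon as their projections are. -/
structure AlgebraicLaxLimit {A B : M.Algebra} (f : A.carrier ⟶ B.carrier) where
  alg : M.Algebra
  fst : alg.carrier ⟶ A.carrier
  cell : Cell alg.carrier B.carrier
  isLaxLimit : IsLaxLimit f fst cell
  isStrict_iff (D : M.Algebra) (x : D.carrier ⟶ alg.carrier) : IsStrict D alg x ↔
    IsStrict D A (x ≫ fst) ∧ IsStrict D B (x ≫ cell.src)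

/-! ### Recovering `δ` from lifted lax limits. -/

namespace AlgebraicLaxLimit

section

variable {A B : M.Algebra} {f : A.carrier ⟶ B.carrier} (s : AlgebraicLaxLimit f)

/-- The identity of the lax limit is strict, so detection of strictness applies to it. -/
theorem isStrict_fst : IsStrict s.alg A s.fst := by
  simpa [Strict.id_comp] using ((s.isStrict_iff s.alg _).1 (isStrict_id _)).1

theorem isStrict_src : IsStrict s.alg B s.cell.src := by
  simpa [Strict.id_comp] using ((s.isStrict_iff s.alg _).1 (isStrict_id _)).2

theorem exists_section : ∃ x : A.carrier ⟶ s.alg.carrier, x ≫ s.fst = 𝟙 _ ∧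
    wl x s.cell = idc f :=
  (s.isLaxLimit.existsUnique (𝟙 _) (idc f) (Strict.id_comp _).symm).exists

/-- The section of the projection that corresponds to the identity 2-cell. -/
noncomputable def sec : A.carrier ⟶ s.alg.carrier := s.exists_section.choose

theorem sec_fst : s.sec ≫ s.fst = 𝟙 _ := s.exists_section.choose_spec.1

theorem sec_cell : wl s.sec s.cell = idc f := s.exists_section.choose_spec.2

end

section

variable {X : C} {B : M.Algebra} {f : (M.free X).carrier ⟶ B.carrier} (s : AlgebraicLaxLimit f)

/-- The strict 1-cell that agrees with the section on generators. -/
noncomputable def strictSec : M.T.obj X ⟶ s.alg.carrier := M.T.map (M.i X ≫ s.sec) ≫ s.alg.str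

theorem isStrict_strictSec : IsStrict (M.free X) s.alg s.strictSec := isStrict_extend _

theorem i_strictSec : M.i X ≫ s.strictSec = M.i X ≫ s.sec := i_extend _

theorem strictSec_fst : s.strictSec ≫ s.fst = 𝟙 (M.T.obj X) := by
  refine (s.isStrict_strictSec.comp s.isStrict_fst).hom_ext (isStrict_id (M.free X)) ?_
  rw [← Strict.assoc, i_strictSec, Strict.assoc, sec_fst]

/-- The comparison from the strict extension of the restriction of `f` along the unit to `f`. -/
noncomputable def counit : Cell (M.T.obj X) B.carrier := wl s.strictSec s.cell

theorem counit_tgt : s.counit.tgt = f := by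
  change s.strictSec ≫ s.cell.tgt = f
  rw [s.isLaxLimit.tgt, ← Strict.assoc, strictSec_fst, Strict.id_comp]

theorem isStrict_counit_src : IsStrict (M.free X) B s.counit.src :=
  s.isStrict_strictSec.comp s.isStrict_src

/-- On generators the strict section agrees with `sec`, along which the limit cell is an identity.
-/
theorem i_counit : wl (M.i X) s.counit = idc (M.i X ≫ f) := by
  unfold counit
  rw [wl_wl, i_strictSec, ← wl_wl, sec_cell, wl_idc]

/-- Naturality of the counit with respect to squares of 1-cells with strict vertical sides. -/
theorem counit_naturality {Y : C} {B' : M.Algebra} {f' : (M.free Y).carrier ⟶ B'.carrier}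
    (s' : AlgebraicLaxLimit f') {g : X ⟶ Y} {h : B.carrier ⟶ B'.carrier} (hh : IsStrict B B' h)
    (w : f ≫ h = M.T.map g ≫ f') : wr s.counit h = wl (M.T.map g) s'.counit := by
  have hw : (wr s.cell h).tgt = (s.fst ≫ M.T.map g) ≫ f' := by
    change s.cell.tgt ≫ h = _
    rw [s.isLaxLimit.tgt, Strict.assoc, w, Strict.assoc]
  -- The square induces `u` between the lax limits. It is strict because its projections are, and it
  -- commutes with the sections by the universal property; hence it commutes with the strict
  -- sections, since these are compared on generators.
  obtain ⟨u, ⟨hu₁, hu₂⟩, -⟩ := s'.isLaxLimit.existsUnique _ _ hw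
  have hu : IsStrict s.alg s'.alg u := by
    rw [s'.isStrict_iff, hu₁, show u ≫ s'.cell.src = s.cell.src ≫ h from congrArg Cell.src hu₂]
    exact ⟨s.isStrict_fst.comp (isStrict_free_map g), s.isStrict_src.comp hh⟩
  have hsec : s.sec ≫ u = M.T.map g ≫ s'.sec := by
    refine s'.isLaxLimit.hom_ext ?_ ?_
    · rw [Strict.assoc, hu₁, ← Strict.assoc, sec_fst, Strict.assoc, sec_fst]
      exact (Strict.id_comp _).trans (Strict.comp_id _).symm
    · rw [← wl_wl, hu₂, ← wl_wr, sec_cell, ← wl_wl, sec_cell, idc_wr, wl_idc, w]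
  have ht : s.strictSec ≫ u = M.T.map g ≫ s'.strictSec := by
    refine (s.isStrict_strictSec.comp hu).hom_ext
      ((isStrict_free_map g).comp s'.isStrict_strictSec) ?_
    rw [← Strict.assoc, i_strictSec, Strict.assoc, hsec, ← Strict.assoc, ← Strict.assoc,
      ← M.i_naturality, Strict.assoc, Strict.assoc, i_strictSec]
  unfold counit
  rw [wl_wr, ← hu₂, wl_wl, ht, wl_wl]

/-- The counit at a strict 1-cell is an identity. -/
theorem counit_of_isStrict (hf : IsStrict (M.free X) B f) : s.counit = idc f := by
  -- Both projections of `sec`, namely the identity and `f`, are strict; thus `sec` is already its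
  -- own strict replacement.
  have hs : IsStrict (M.free X) s.alg s.sec := by
    rw [s.isStrict_iff, sec_fst, show s.sec ≫ s.cell.src = f from congrArg Cell.src s.sec_cell]
    exact ⟨isStrict_id _, hf⟩
  unfold counit
  rw [s.isStrict_strictSec.hom_ext hs s.i_strictSec, sec_cell]

end

end AlgebraicLaxLimit

/-- The cell `δ_X` is the counit at `i_{TX}`. Its source is the strict 1-cell restricting to `i_X ≫
i_{TX} = i_X ≫ T i_X`, hence `T i_X`. -/
theorem nonempty_laxIdempotency
    (H : ∀ (A B : M.Algebra) (f : A.carrier ⟶ B.carrier), Nonempty (AlgebraicLaxLimit f)) :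
    Nonempty M.LaxIdempotency := by
  let s {A B : M.Algebra} (f : A.carrier ⟶ B.carrier) := (H A B f).some
  let δ (X : C) := (s (A := M.free X) (B := M.free (M.T.obj X)) (M.i (M.T.obj X))).counit
  refine ⟨⟨δ, fun X => ?_, fun X => ?_, fun {X Y} f => ?_, fun X => ?_, fun X => ?_⟩⟩
  · refine (AlgebraicLaxLimit.isStrict_counit_src _).hom_ext (isStrict_free_map _) ?_
    exact (congrArg Cell.src (AlgebraicLaxLimit.i_counit _)).trans (M.i_naturality _)
  · exact AlgebraicLaxLimit.counit_tgt _
  · exact AlgebraicLaxLimit.counit_naturality _ _ (isStrict_free_map _) (M.i_naturality _).symm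
  -- The unit law `i_{TX} ≫ m_X = 1` is a square from `i_{TX}` to `1` with strict sides `1` and
  -- `m_X`. Naturality identifies `m · δ` with the counit at the strict 1-cell `1`, an identity.
  · have h := AlgebraicLaxLimit.counit_naturality
      (s (A := M.free X) (B := M.free (M.T.obj X)) (M.i (M.T.obj X))) (s (A := M.free X) (B := M.free X) (𝟙 _))
      (g := 𝟙 X) (h := M.m X) (isStrict_str (M.free X)) (by
        rw [M.T.map_id]
        exact (M.i_m X).trans (Strict.id_comp _).symm)
    rw [M.T.map_id, id_wl, AlgebraicLaxLimit.counit_of_isStrict _ (isStrict_id (M.free X))] at h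
    exact h
  · exact AlgebraicLaxLimit.i_counit _

end TwoMonad
end LaxIdem

namespace LaxIdem

/-! ### Lax limits of 1-cells as weighted limits. -/

section LaxLimits

/-- The objects of the category with a single non-identity arrow. -/
inductive ArrowShape : Type v
  | dom
  | cod

namespace ArrowShape

/-- The arrows of the category with a single non-identity arrow. -/
inductive Hom : ArrowShape.{v} → ArrowShape.{v} → Type v
  | id (a : ArrowShape) : Hom a a
  | arrow : Hom dom cod

instance : SmallCategory ArrowShape.{v} where
  Hom := Hom
  id := Hom.id
  comp {a b c} f g := match a, b, c, f, g with
    | _, _, _, .id _, g => g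
    | _, _, _, .arrow, .id _ => .arrow
  id_comp _ := rfl
  comp_id f := by cases f <;> rfl
  assoc f g h := by cases f <;> cases g <;> cases h <;> rfl

theorem hom_subsingleton {a b : ArrowShape.{v}} (f g : Hom a b) : f = g := by
  cases f <;> cases g <;> rfl

/-- The walking arrow as a 2-category. -/
abbrev J : Type v := LocallyDiscrete ArrowShape.{v}

/-- The non-identity arrow. -/
abbrev arrow : (⟨dom⟩ : J.{v}) ⟶ ⟨cod⟩ := ⟨Hom.arrow⟩

variable {C : Type u} [Bicategory.{v, v} C]

/-- The map on objects of the functor that picks out an arrow. -/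
@[reducible]
def obj (A B : C) : ArrowShape.{v} → C
  | dom => A
  | cod => B

/-- The map on arrows of the functor that picks out an arrow. -/
def map {A B : C} (f : A ⟶ B) : {a b : ArrowShape.{v}} → Hom a b → (obj A B a ⟶ obj A B b)
  | _, _, .id a => 𝟙 (obj A B a)
  | _, _, .arrow => f

variable [Strict C]

theorem map_comp {A B : C} (f : A ⟶ B) {a b c : ArrowShape.{v}} (g : a ⟶ b) (h : b ⟶ c) :
    map f (g ≫ h) = map f g ≫ map f h := by
  change Hom a b at g
  change Hom b c at h
  cases g with
  | id => exact (Strict.id_comp _).symm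
  | arrow => cases h; exact (Strict.comp_id _).symm

/-- The 2-functor out of the walking arrow that picks out a 1-cell. -/
def functor {A B : C} (f : A ⟶ B) : StrictPseudofunctor J.{v} C :=
  StrictPseudofunctor.mk''
    { obj := fun a => obj A B a.as
      map := fun g => map f g.as
      map₂ := fun η => eqToHom (congrArg (fun g => map f g.as) (LocallyDiscrete.eq_of_hom η))
      map_id := fun _ => rfl
      map_comp := fun g h => map_comp f g.as h.as
      map₂_whisker_left := fun f _ _ η => by
        obtain rfl := LocallyDiscrete.eq_of_hom η
        simp
      map₂_whisker_right := fun η g => by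
        obtain rfl := LocallyDiscrete.eq_of_hom η
        simp }

/-- The arrow category, in the universe of hom-categories. -/
abbrev Two : Type v := AsSmall.{v} (Fin 2)

/-- The objects of the arrow category. -/
abbrev Two.mk (i : Fin 2) : Two.{v} := AsSmall.up.obj i

/-- The non-identity arrow of the arrow category. -/
abbrev twoArrow : Two.mk.{v} 0 ⟶ Two.mk 1 := AsSmall.up.map (homOfLE (Fin.zero_le 1))

/-- The weight for lax limits of 1-cells. -/
def weight : StrictPseudofunctor J.{v} Cat.{v, v} :=
  functor (A := Cat.of (Discrete PUnit.{v + 1})) (B := Cat.of Two.{v})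
    -- Choosing the endpoint `1` makes `p ≫ f` the target, rather than the source, of the limit
    -- cell.
    ((Functor.const _).obj (Two.mk 1)).toCatHom

theorem punit_functor_ext {K : Type u} [Category.{v} K] {G H : Discrete PUnit.{v + 1} ⥤ K}
    (h : G.obj ⟨PUnit.unit⟩ = H.obj ⟨PUnit.unit⟩) : G = H := by
  refine Functor.hext (fun _ => h) ?_
  rintro ⟨⟨⟩⟩ ⟨⟨⟩⟩ f
  obtain rfl : f = 𝟙 _ := Subsingleton.elim _ _
  rw [G.map_id, H.map_id, h]

theorem two_functor_ext {K : Type u} [Category.{v} K] {G H : Two.{v} ⥤ K}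
    (h₀ : G.obj (Two.mk 0) = H.obj (Two.mk 0)) (h₁ : G.obj (Two.mk 1) = H.obj (Two.mk 1))
    (h : HEq (G.map twoArrow) (H.map twoArrow)) : G = H := by
  have hobj : ∀ i, G.obj i = H.obj i := by
    rintro ⟨i⟩
    fin_cases i
    exacts [h₀, h₁]
  refine Functor.hext hobj ?_
  have hid (i : Two.{v}) (f : i ⟶ i) : HEq (G.map f) (H.map f) := by
    obtain rfl : f = 𝟙 i := rfl
    rw [G.map_id, H.map_id, hobj]
  rintro ⟨i⟩ ⟨j⟩ f
  fin_cases i <;> fin_cases j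
  · exact hid _ f
  · exact h
  · exact absurd f.down.le (by decide)
  · exact hid _ f

end ArrowShape

open ArrowShape

namespace WeightedCone

variable {C : Type u} [Bicategory.{v, v} C] {F : StrictPseudofunctor J.{v} C}

/-- The projection of a cone to the domain. -/
def fst {X : C} (c : WeightedCone weight F X) : X ⟶ F.obj ⟨dom⟩ :=
  (c.leg ⟨dom⟩).obj (Discrete.mk PUnit.unit : Discrete PUnit.{v + 1})

/-- The 2-cell of a cone. -/
def cell {X : C} (c : WeightedCone weight F X) : Cell X (F.obj ⟨cod⟩) :=
  ⟨_, _, (c.leg ⟨cod⟩).map twoArrow⟩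

theorem cell_tgt {X : C} (c : WeightedCone weight F X) : c.cell.tgt = c.fst ≫ F.map arrow :=
  c.naturality_obj arrow (Discrete.mk PUnit.unit : Discrete PUnit.{v + 1})

theorem ext_of_cell {X : C} {c d : WeightedCone weight F X} (h₁ : c.fst = d.fst)
    (h₂ : c.cell = d.cell) : c = d := by
  refine WeightedCone.ext (funext ?_)
  rintro ⟨_ | _⟩
  · exact punit_functor_ext h₁
  · exact two_functor_ext (congrArg Cell.src h₂) (congrArg Cell.tgt h₂) (Cell.heq_of_eq h₂)

variable [Strict C]

/-- The legs of the cone that corresponds to a 1-cell and a 2-cell. -/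
def legOfCell {X : C} (x : X ⟶ F.obj ⟨dom⟩) (d : Cell X (F.obj ⟨cod⟩)) :
    (a : ArrowShape.{v}) → ((obj (Cat.of (Discrete PUnit.{v + 1})) (Cat.of Two.{v}) a : Cat.{v, v}) ⥤
      (X ⟶ F.obj ⟨a⟩))
  | dom => (Functor.const (Discrete PUnit.{v + 1})).obj x
  | cod => (AsSmall.down ⋙ ComposableArrows.mk₁ d.hom : Two.{v} ⥤ _)

theorem legOfCell_naturality {X : C} {x : X ⟶ F.obj ⟨dom⟩} {d : Cell X (F.obj ⟨cod⟩)}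
    (h : d.tgt = x ≫ F.map arrow) {j k : J.{v}} (a : j ⟶ k) (y : weight.obj j) :
    (legOfCell x d k.as).obj ((weight.map a).toFunctor.obj y) =
      (legOfCell x d j.as).obj y ≫ F.map a := by
  obtain ⟨j⟩ := j
  obtain ⟨k⟩ := k
  obtain ⟨a⟩ := a
  change ArrowShape.Hom j k at a
  cases a with
  | id => exact (Strict.comp_id _).symm.trans (congrArg _ (F.map_id _).symm)
  | arrow => exact h

/-- The cone that corresponds to a 1-cell and a 2-cell. -/
def ofCell {X : C} (x : X ⟶ F.obj ⟨dom⟩) (d : Cell X (F.obj ⟨cod⟩))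
    (h : d.tgt = x ≫ F.map arrow) : WeightedCone weight F X where
  leg j := legOfCell x d j.as
  naturality_obj a y := legOfCell_naturality h a y
  naturality_map {j k} a y z f := by
    obtain ⟨j⟩ := j
    obtain ⟨k⟩ := k
    obtain ⟨a⟩ := a
    change ArrowShape.Hom j k at a
    cases a with
    | id =>
      refine HEq.trans ?_ (whiskerRight_heq (F.map_id ⟨j⟩).symm rfl rfl HEq.rfl)
      exact (Cell.heq_of_eq (Cell.wr_id ⟨_, _, (legOfCell x d j).map f⟩)).symm
    | arrow =>
      refine (?_ : HEq (𝟙 d.tgt) (𝟙 x ▷ F.map arrow))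
      rw [id_whiskerRight, h]
  naturality_two {j k a b} η y := by
    obtain rfl := LocallyDiscrete.eq_of_hom η
    obtain rfl : η = 𝟙 _ := Subsingleton.elim _ _
    rw [F.map₂_id, whiskerLeft_id, weight.map₂_id]
    refine HEq.trans (heq_of_eq ((legOfCell x d k.as).map_id _)) ?_
    rw [← legOfCell_naturality h a y]

/-- Limit cones for the weight `weight` are lax limits of 1-cells. -/
theorem IsLimit.isLaxLimit {L : C} {c : WeightedCone weight F L} (hc : c.IsLimit) :
    IsLaxLimit (F.map arrow) c.fst c.cell where
  tgt := c.cell_tgt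
  existsUnique {Z} x d h := by
    obtain ⟨y, hy⟩ := (hc Z).1.2 (ofCell x d h)
    refine ⟨y, ⟨congrArg fst hy, congrArg cell hy⟩, fun z ⟨hz₁, hz₂⟩ => (hc Z).1.1 ?_⟩
    refine ext_of_cell (hz₁.trans (congrArg fst hy).symm) (hz₂.trans (congrArg cell hy).symm)

end WeightedCone

/-! ### The walking arrow and the weight lie in the base. -/

namespace IsBase

open Limits

variable {V : ObjectProperty Cat.{v, v}} (hV : IsBase V)
include hV

/-- The terminal category is the empty product. -/
theorem of_unique (K : Type v) [SmallCategory K] [Unique K] [IsDiscrete K] : V (Cat.of K) := by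
  have := hV.limits (Discrete PEmpty.{v + 1})
  have : V.IsClosedUnderLimitsOfShape (Discrete PEmpty.{1}) :=
    .of_equivalence (Discrete.equivalence (Equiv.equivOfIsEmpty PEmpty.{v + 1} PEmpty.{1}))
  exact V.prop_of_isLimit (Cat.isTerminalOfUniqueOfIsDiscrete (T := K)) (fun j => j.as.elim)

/-- The empty category is the equalizer of the constant endofunctors of the arrow category at `0`
and `1`. It is needed as the hom-category from `cod` to `dom` in the walking arrow. -/
theorem of_isEmpty (K : Type v) [SmallCategory K] [IsEmpty K] : V (Cat.of K) := by
  have := hV.limits (AsSmall.{v} WalkingParallelPair)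
  have : V.IsClosedUnderLimitsOfShape WalkingParallelPair :=
    .of_equivalence AsSmall.equiv.symm
  let g (i : Fin 2) : Cat.of Two.{v} ⟶ Cat.of Two.{v} :=
    ((Functor.const _).obj (Two.mk i)).toCatHom
  have hempty (X Y : Cat.{v, v}) [IsEmpty X] (F G : X ⟶ Y) : F = G :=
    Cat.Hom.ext (Functor.hext (fun x : X => (IsEmpty.false x).elim)
      (fun x : X => (IsEmpty.false x).elim))
  have : IsEmpty (Cat.of K) := ‹IsEmpty K›
  let e (X : Cat.{v, v}) [IsEmpty X] (Y : Cat.{v, v}) : X ⟶ Y := Functor.toCatHom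
    { obj := fun x => isEmptyElim x
      map := fun {x _} _ => (IsEmpty.false x).elim
      map_id := fun x => (IsEmpty.false x).elim
      map_comp := fun {x _ _} _ _ => (IsEmpty.false x).elim }
  have h : IsLimit (Fork.ofι (f := g 0) (g := g 1) (e (Cat.of K) _) (hempty _ _ _ _)) := by
    refine Fork.IsLimit.mk' _ fun s => ?_
    have : IsEmpty s.pt := ⟨fun x => by
      have h := congrArg (fun F : s.pt ⟶ Cat.of Two.{v} => AsSmall.down.obj (F.toFunctor.obj x)) s.condition
      exact absurd (show (0 : Fin 2) = 1 from h) (by decide)⟩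
    exact ⟨e _ _, hempty _ _ _ _, fun _ => hempty _ _ _ _⟩
  refine V.prop_of_isLimit h ?_
  rintro (_ | _)
  exacts [hV.two, hV.two]

theorem isVCategory_arrowShape : IsVCategory V J.{v} := by
  intro a b
  have hsub (f g : a ⟶ b) : f = g := congrArg Discrete.mk (hom_subsingleton _ _)
  rcases isEmpty_or_nonempty (a ⟶ b) with h | ⟨⟨f⟩⟩
  · exact hV.of_isEmpty _
  · let : Unique (a ⟶ b) := ⟨⟨f⟩, fun g => hsub _ _⟩
    exact hV.of_unique _

theorem weight_obj (j : J.{v}) : V (weight.obj j) := by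
  obtain ⟨_ | _⟩ := j
  · exact hV.of_unique (Discrete PUnit)
  · exact hV.two

end IsBase

variable {C : Type u₁} [Bicategory.{v, v} C] [Strict C] {D : Type u₂} [Bicategory.{v, v} D]
  [Strict D]

/-- Complete `V`-categories have lax limits of 1-cells, and continuous `V`-functors preserve
them. -/
theorem IsVComplete.exists_isLaxLimit {V : ObjectProperty Cat.{v, v}} (hV : IsBase V)
    (hC : IsVComplete V C) {W : StrictPseudofunctor C D} (hW : IsVContinuous V W) {A B : C}
    (f : A ⟶ B) : ∃ (L : C) (p : L ⟶ A) (c : Cell L B), IsLaxLimit f p c ∧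
      IsLaxLimit (W.map f) (W.map p) (c.map W) := by
  obtain ⟨L, c, hc⟩ := hC J hV.isVCategory_arrowShape weight hV.weight_obj (functor f)
  have h := hW J hV.isVCategory_arrowShape weight hV.weight_obj (functor f) L c hc
  exact ⟨L, c.fst, c.cell, hc.isLaxLimit, h.isLaxLimit⟩

end LaxLimits

end LaxIdem

namespace LaxIdem

/-! ### Transport of the lifting condition along the pullback. -/

section Pullback

open TwoMonad

theorem map_heq_of_eq {C : Type u₁} [Bicategory.{v, v} C] {D : Type u₂} [Bicategory.{v, v} D]
    {F F' : StrictPseudofunctor C D} (h : F = F') {X Y : C} (f : X ⟶ Y) :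
    HEq (F.map f) (F'.map f) := by
  subst h; rfl

/-- Commutativity of the square identifies the carrier of `G D` with `W D` only propositionally;
this replaces `G D` by an equal algebra whose carrier is `W D` by definition. -/
theorem TwoMonad.exists_algebra_eq {B : Type u} [Bicategory.{v, v} B] [Strict B] {S : TwoMonad B}
    {X : B} (K : S.Algebra) (h : X = K.carrier) :
    ∃ (l : S.T.obj X ⟶ X) (hu : S.i X ≫ l = 𝟙 X) (ha : S.m X ≫ l = S.T.map l ≫ l),
      (⟨X, l, hu, ha⟩ : S.Algebra) = K := by
  subst h; exact ⟨K.str, K.unit, K.assoc, rfl⟩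

variable {C : Type u₁} [Bicategory.{v, v} C] [Strict C] {B : Type u₂} [Bicategory.{v, v} B]
  [Strict B] {T : TwoMonad C} {S : TwoMonad B} {W : StrictPseudofunctor C B}
  {G : StrictPseudofunctor T.Algebra S.Algebra}
  (hG : IsPullbackSquare T.forget G W S.forget)
include hG

/-- Strictness of 1-cells is detected by the pullback. -/
theorem IsPullbackSquare.isStrict_iff {A A' : T.Algebra} {K K' : S.Algebra} (hK : K = G.obj A)
    (hK' : K' = G.obj A') (x : A.carrier ⟶ A'.carrier) (y : K.carrier ⟶ K'.carrier)
    (hy : HEq y (W.map x)) : IsStrict A A' x ↔ IsStrict K K' y := by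
  subst hK hK'
  constructor
  · intro hx
    let h : A ⟶ A' := ⟨x, hx⟩
    have hh : HEq (W.map x) (S.forget.map (G.map h)) := map_heq_of_eq hG.comm h
    obtain rfl : y = Algebra.Hom.hom (G.map h) := eq_of_heq (hy.trans hh)
    exact Algebra.Hom.comm (G.map h)
  · intro hs
    -- The pair of `x` and the `S`-morphism on `y` is compatible, so it comes from a `T`-morphism
    -- whose underlying 1-cell is `x`.
    obtain ⟨h, ⟨rfl, -⟩, -⟩ := hG.lift_map (a := A) (a' := A') x ⟨y, hs⟩ hy.symm
    exact Algebra.Hom.comm h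

/-- Lax limits lift along the forgetful 2-functor of a pullback of a lax idempotent 2-monad. -/
theorem IsPullbackSquare.nonempty_algebraicLaxLimit (hS : S.LaxIdempotency) {A A' : T.Algebra}
    {f : A.carrier ⟶ A'.carrier} {L : C} {p : L ⟶ A.carrier} {c : Cell L A'.carrier}
    (hc : IsLaxLimit f p c) (hWc : IsLaxLimit (W.map f) (W.map p) (c.map W)) :
    Nonempty (AlgebraicLaxLimit f) := by
  have hobj (D : T.Algebra) : W.obj D.carrier = (G.obj D).carrier :=
    congrArg (fun F : StrictPseudofunctor T.Algebra B => F.obj D) hG.comm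
  choose l hu ha hK using fun D => exists_algebra_eq (G.obj D) (hobj D)
  let K (D : T.Algebra) : S.Algebra := ⟨W.obj D.carrier, l D, hu D, ha D⟩
  obtain ⟨e, heu, hea, he⟩ := hS.exists_algebra (A := K A) (B := K A') hWc
  -- The `S`-algebra lifted to `W L` and the object `L` form a compatible pair, so the pullback
  -- gives a `T`-algebra on `L`.
  obtain ⟨E, ⟨rfl, hE⟩, -⟩ := hG.lift_obj L ⟨W.obj L, e, heu, hea⟩ rfl
  refine ⟨⟨E, p, c, hc, fun D x => ?_⟩⟩
  have h₁ := hG.isStrict_iff (hK D) hE.symm x (W.map x) HEq.rfl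
  have h₂ := hG.isStrict_iff (hK D) (hK A) (x ≫ p) (W.map x ≫ W.map p)
    (heq_of_eq (W.map_comp _ _).symm)
  have h₃ := hG.isStrict_iff (hK D) (hK A') (x ≫ c.src) (W.map x ≫ W.map c.src)
    (heq_of_eq (W.map_comp _ _).symm)
  rw [h₁, h₂, h₃]
  exact he (K D) (W.map x)

end Pullback

end LaxIdem

theorem mainTheorem12 (V : ObjectProperty Cat.{v, v}) (hV : LaxIdem.IsBase V)
    {C : Type u₁} [Bicategory.{v, v} C] [Bicategory.Strict C]
    {B : Type u₂} [Bicategory.{v, v} B] [Bicategory.Strict B]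
    (hC : LaxIdem.IsVCategory V C) (hB : LaxIdem.IsVCategory V B)
    (hCcomplete : LaxIdem.IsVComplete V C) (hBcomplete : LaxIdem.IsVComplete V B)
    (T : LaxIdem.TwoMonad C) (S : LaxIdem.TwoMonad B)
    (W : StrictPseudofunctor C B) (hW : LaxIdem.IsVContinuous V W)
    (G : StrictPseudofunctor T.Algebra S.Algebra)
    (hG : LaxIdem.IsPullbackSquare T.forget G W S.forget)
    (hS : S.IsLaxIdempotent) :
    T.IsLaxIdempotent := by
  obtain ⟨S'⟩ := S.isLaxIdempotent_iff.1 hS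
  refine T.isLaxIdempotent_iff.2 (LaxIdem.TwoMonad.nonempty_laxIdempotency fun A A' f => ?_)
  obtain ⟨L, p, c, hc, hWc⟩ := hCcomplete.exists_isLaxLimit hV hW f
  exact hG.nonempty_algebraicLaxLimit S' hc hWc
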